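/- Let $(P,d)$ be a finite nonempty metric space whose points are called sites. A patrol schedule for $k$ robots of maximum speed $1$ specifies for each robot an infinite sequence of sites $s_0,s_1,\dots$ with arrival times $a_n$ and departure times $b_n$ such that $0\le a_0$, $a_n\le b_n$, $d(s_n,s_{n+1})\le a_{n+1}-b_n$ and $a_n\to\infty$; the robot is at $s_n$ during $[a_n,b_n]$, and a site is visited at time $t$ if some robot is at it at time $t$. The latency of a site is the supremum of $t_2-t_1$ over all $0\le t_1<t_2$ such that the site is not visited during $(t_1,t_2)$ (and $0$ if there are no such $t_1,t_2$), and the latency of a schedule is the maximum latency of its sites. A cyclic solution is a patrol schedule of the following form: $P$ is partitioned into nonempty groups $P_1,\dots,P_\ell$ with $\ell\le k$, each $P_i$ is assigned $k_i\ge 1$ robots with $\sum_{i=1}^{\ell} k_i=k$, and these $k_i$ robots, spaced evenly along a travelling salesman tour $T_i$ of $P_i$ (that is, at distance $\|T_i\|/k_i$ from each other along the tour), traverse $T_i$ forever at unit speed in the same direction; if $P_i$ is a single site, they stay there. A cyclic solution is an optimal cyclic solution if its latency is minimum among all cyclic solutions for $k$ robots on $P$. For $k=2$ robots, an optimal cyclic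 solution exists, and every optimal cyclic solution has minimum latency among all patrol schedules for two robots on $P$. -/

import Mathlib

open scoped ENNReal

namespace Patrol

/-- The timed itinerary of one robot of maximum speed `1` in the finite metric space `P`: an
infinite sequence of sites, together with the times at which the robot reaches and leaves the
successive sites of the sequence. The robot may wait at sites (`arrive n < depart n`), it may travel
more slowly than at unit speed, and it may be on its way to its first site at time `0`. -/
structure RobotSchedule (P : Type*) [MetricSpace P] where
  site : ℕ → P
  arrive : ℕ → ℝ
  depart : ℕ → ℝ
  arrive_zero_nonneg : 0 ≤ arrive 0
  arrive_le_depart : ∀ n, arrive n ≤ depart n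
  speed_le_one : ∀ n, dist (site n) (site (n + 1)) ≤ arrive (n + 1) - depart n
  tendsto_arrive : Filter.Tendsto arrive Filter.atTop Filter.atTop

/-- At time `t` the robot is at the site `s`. -/
def RobotSchedule.IsAt {P : Type*} [MetricSpace P] (f : RobotSchedule P) (t : ℝ) (s : P) : Prop :=
  ∃ n, f.site n = s ∧ f.arrive n ≤ t ∧ t ≤ f.depart n

/-- A patrol schedule for `k` robots. -/
abbrev PatrolSchedule (k : ℕ) (P : Type*) [MetricSpace P] := Fin k → RobotSchedule P

section Schedules

variable {k : ℕ} {P : Type*} [MetricSpace P]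

/-- The site `s` is visited by some robot at time `t`. -/
def Visited (σ : PatrolSchedule k P) (s : P) (t : ℝ) : Prop :=
  ∃ r, (σ r).IsAt t s

/-- The latency of a site: the supremum of the lengths of the time intervals (from time `0` on)
during which the site is not visited. It is `⊤` if the site is left unvisited from some time on, and
`0` if the site is never left unattended. -/
noncomputable def siteLatency (σ : PatrolSchedule k P) (s : P) : ℝ≥0∞ :=
  ⨆ (t₁ : ℝ) (t₂ : ℝ) (_ : 0 ≤ t₁) (_ : t₁ < t₂)
    (_ : ∀ t, t₁ < t → t < t₂ → ¬ Visited σ s t), ENNReal.ofReal (t₂ - t₁)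

/-- The latency of a patrol schedule: the maximum latency of its sites. -/
noncomputable def latency (σ : PatrolSchedule k P) : ℝ≥0∞ :=
  ⨆ s, siteLatency σ s

/-- `σ` has minimum latency among all patrol schedules for the same number of robots. -/
def IsOptimal (σ : PatrolSchedule k P) : Prop :=
  ∀ τ : PatrolSchedule k P, latency σ ≤ latency τ

end Schedules

/-- A closed tour that visits each element of `A` exactly once per round, unrolled to a periodic
sequence: one round is `vertex 0, …, vertex (size - 1)`, followed by the return to `vertex 0`. -/
structure Tour {P : Type*} [MetricSpace P] (A : Set P) where
  size : ℕ
  size_pos : 0 < size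
  vertex : ℕ → P
  periodic : ∀ n, vertex (n + size) = vertex n
  bijOn : Set.BijOn vertex (Set.Iio size) A

namespace Tour

variable {P : Type*} [MetricSpace P] {A : Set P}

/-- The distance travelled along the (unrolled) tour from `vertex 0` to `vertex n`. -/
noncomputable def dist₀ (T : Tour A) (n : ℕ) : ℝ :=
  ∑ i ∈ Finset.range n, dist (T.vertex i) (T.vertex (i + 1))

/-- The length of one round of the tour. -/
noncomputable def length (T : Tour A) : ℝ := T.dist₀ T.size

/-- `T` is a travelling salesman tour of `A`. -/
def IsTSP (T : Tour A) : Prop := ∀ T' : Tour A, T.length ≤ T'.length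

/-- The point of the closed tour that is reached from `vertex 0` after travelling the distance `x`
(taken modulo the length of the tour) is the site `s`. A tour of length `0` has only one point, and
every `x` describes this point. -/
def PointIs (T : Tour A) (x : ℝ) (s : P) : Prop :=
  ∃ n : ℕ, T.vertex n = s ∧ (T.length = 0 ∨ ∃ q : ℤ, x = T.dist₀ n + q * T.length)

end Tour

/-- The data of a cyclic solution for `k` robots: a partition of the sites into nonempty groups,
a nonempty team of robots for each group (every robot is in exactly one team, so there are at most
`k` groups and the team sizes add up to `k`), a travelling salesman tour of each group, an
enumeration `index` of the robots in each team by `0, …, teamSize - 1`, and the point of the tour,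
given by the distance travelled from its first vertex, at which robot number `0` starts. -/
structure CyclicPlan (k : ℕ) (P : Type*) [MetricSpace P] where
  numGroups : ℕ
  group : P → Fin numGroups
  group_surjective : Function.Surjective group
  team : Fin k → Fin numGroups
  team_surjective : Function.Surjective team
  tour : ∀ i, Tour {s | group s = i}
  tour_isTSP : ∀ i, (tour i).IsTSP
  index : Fin k → ℕ
  index_bijOn : ∀ i, Set.BijOn index {r | team r = i} (Set.Iio {r | team r = i}.ncard)
  start : Fin numGroups → ℝ

section Cyclic

variable {k : ℕ} {P : Type*} [MetricSpace P]

/-- The number of robots assigned to the group `i`. -/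
noncomputable def CyclicPlan.teamSize (C : CyclicPlan k P) (i : Fin C.numGroups) : ℕ :=
  {r | C.team r = i}.ncard

/-- The starting point of robot `r` on its tour: the robots of a team are spaced evenly, at distance
`length / teamSize` along the tour. -/
noncomputable def CyclicPlan.offset (C : CyclicPlan k P) (r : Fin k) : ℝ :=
  C.start (C.team r) + C.index r * ((C.tour (C.team r)).length / C.teamSize (C.team r))

/-- A cyclic solution: a patrol schedule in which the sites are partitioned into groups and the
robots of each team, evenly spaced, traverse a travelling salesman tour of their group at unit
speed. (Robots of a team whose group is a single site stay at this site.) -/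
def IsCyclic (σ : PatrolSchedule k P) : Prop :=
  ∃ C : CyclicPlan k P, ∀ (r : Fin k) (t : ℝ) (s : P), 0 ≤ t →
    ((σ r).IsAt t s ↔ (C.tour (C.team r)).PointIs (C.offset r + t) s)

/-- `σ` is a cyclic solution of minimum latency among all cyclic solutions. -/
def IsOptimalCyclic (σ : PatrolSchedule k P) : Prop :=
  IsCyclic σ ∧ ∀ σ' : PatrolSchedule k P, IsCyclic σ' → latency σ ≤ latency σ'

end Cyclic

end Patrol

/-!
Let a schedule of two robots have latency `L`, and let `t > L`. For each site, the last visit before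
`t` and the first visit after `t` bound a time interval of length at most `L`, labelled by the
robots `i` and `j` that make these two visits. Stable matching of the left ends with the right ends
of such intervals, where a left end prefers to be early and a right end prefers to be late, yields
times `l i ≤ t ≤ r i` such that each site is visited by some robot `i` during `[l i, r i]`.

If the matching is the identity, each robot returns to its position at time `l i` at time `r i`, at
most `L` later, so each of the robots closes a tour of length at most `L`. If the matching is the
swap, the robots exchange their positions and jointly close a tour of all sites of length at most
`2 * L`. In both cases some cyclic solution has latency at most `L`.

A stable matching exists unless one robot can take over from the other around time `t`, but not vice
versa. This asymmetry cannot occur at all times `t > L`: the times at which robot `j` can take over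
from robot `i` form a closed set, so by connectedness only one of the two directions would ever be
possible, whereas two take-overs in the same direction at the same site require one in the opposite
direction in between.
-/

namespace Patrol

open Set Filter
open scoped NNReal

namespace Tour

variable {P : Type*} [MetricSpace P] {A : Set P}

lemma dist₀_zero (T : Tour A) : T.dist₀ 0 = 0 := Finset.sum_range_zero _

lemma dist₀_succ (T : Tour A) (n : ℕ) :
    T.dist₀ (n + 1) = T.dist₀ n + dist (T.vertex n) (T.vertex (n + 1)) :=
  Finset.sum_range_succ _ n

lemma dist₀_monotone (T : Tour A) : Monotone T.dist₀ :=
  monotone_nat_of_le_succ fun n => by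
    rw [T.dist₀_succ]
    exact le_add_of_nonneg_right dist_nonneg

lemma length_nonneg (T : Tour A) : 0 ≤ T.length :=
  T.dist₀_zero ▸ T.dist₀_monotone (Nat.zero_le T.size)

lemma dist_vertex_le (T : Tour A) {m n : ℕ} (h : m ≤ n) :
    dist (T.vertex m) (T.vertex n) ≤ T.dist₀ n - T.dist₀ m :=
  (dist_le_Ico_sum_dist T.vertex h).trans_eq (Finset.sum_Ico_eq_sub _ h)

lemma vertex_add_mul_size (T : Tour A) (n q : ℕ) : T.vertex (n + q * T.size) = T.vertex n :=
  Function.Periodic.nat_mul T.periodic q n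

lemma vertex_mod_size (T : Tour A) (n : ℕ) : T.vertex (n % T.size) = T.vertex n :=
  Function.Periodic.map_mod_nat T.periodic n

lemma vertex_mem (T : Tour A) (n : ℕ) : T.vertex n ∈ A :=
  T.vertex_mod_size n ▸ T.bijOn.mapsTo (Nat.mod_lt n T.size_pos)

lemma ncard_eq_size (T : Tour A) : A.ncard = T.size := by
  have h := T.bijOn.injOn.ncard_image
  rwa [T.bijOn.image_eq, ← Finset.coe_Iio, ncard_coe_finset, Nat.card_Iio] at h

lemma dist₀_add_size (T : Tour A) (n : ℕ) : T.dist₀ (n + T.size) = T.dist₀ n + T.length := by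
  induction n with
  | zero => rw [zero_add, T.dist₀_zero, zero_add, length]
  | succ n ih =>
    rw [add_right_comm, dist₀_succ, dist₀_succ, ih, T.periodic, add_right_comm n, T.periodic]
    ring

lemma dist₀_add_mul_size (T : Tour A) (n q : ℕ) :
    T.dist₀ (n + q * T.size) = T.dist₀ n + q * T.length := by
  induction q with
  | zero => simp
  | succ q ih =>
    rw [Nat.succ_mul, ← add_assoc, T.dist₀_add_size, ih]
    push_cast
    ring

lemma vertex_eq_vertex_zero_of_length_le_dist₀ (T : Tour A) {n : ℕ} (hn : n ≤ T.size)
    (h : T.length ≤ T.dist₀ n) : T.vertex n = T.vertex 0 :=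
  calc
    T.vertex n = T.vertex T.size :=
      dist_le_zero.1 ((T.dist_vertex_le hn).trans (sub_nonpos.2 h))
    _ = T.vertex 0 := by simpa using T.periodic 0

lemma vertex_eq_vertex_zero_of_length_eq_zero (T : Tour A) (h : T.length = 0) (n : ℕ) :
    T.vertex n = T.vertex 0 := by
  rw [← T.vertex_mod_size]
  refine T.vertex_eq_vertex_zero_of_length_le_dist₀ (Nat.mod_lt n T.size_pos).le ?_
  rw [h, ← T.dist₀_zero]
  exact T.dist₀_monotone (Nat.zero_le _)

lemma exists_dist₀_eq_add_int_mul_length (T : Tour A) (n : ℕ) (q : ℤ)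
    (h : 0 ≤ T.dist₀ n + q * T.length) :
    ∃ m, T.vertex m = T.vertex n ∧ T.dist₀ m = T.dist₀ n + q * T.length := by
  obtain ⟨r, p, hr, rfl⟩ : ∃ r p, r < T.size ∧ n = r + p * T.size :=
    ⟨n % T.size, n / T.size, Nat.mod_lt n T.size_pos, (Nat.mod_add_div' n T.size).symm⟩
  have hsum : T.dist₀ (r + p * T.size) + q * T.length
      = T.dist₀ r + ((p + q : ℤ) : ℝ) * T.length := by
    rw [T.dist₀_add_mul_size]
    push_cast
    ring
  rw [T.vertex_add_mul_size, hsum]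
  rw [hsum] at h
  rcases le_or_gt 0 ((p : ℤ) + q) with hpq | hpq
  · obtain ⟨d, hd⟩ := Int.eq_ofNat_of_zero_le hpq
    refine ⟨r + d * T.size, T.vertex_add_mul_size r d, ?_⟩
    rw [T.dist₀_add_mul_size, hd, Int.cast_natCast]
  -- A negative multiple can only lead from the end of a round back to its beginning.
  · have hle : T.dist₀ r ≤ T.length := T.dist₀_monotone hr.le
    have hround : ((p + q : ℤ) : ℝ) * T.length ≤ -1 * T.length :=
      mul_le_mul_of_nonneg_right (mod_cast Int.le_sub_one_of_lt hpq) T.length_nonneg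
    refine ⟨0, (T.vertex_eq_vertex_zero_of_length_le_dist₀ hr.le (by linarith)).symm, ?_⟩
    rw [T.dist₀_zero]
    linarith

lemma tendsto_dist₀ (T : Tour A) (h : 0 < T.length) : Tendsto T.dist₀ atTop atTop := by
  refine tendsto_atTop_atTop_of_monotone T.dist₀_monotone fun b => ?_
  obtain ⟨q, hq⟩ := exists_nat_ge (b / T.length)
  refine ⟨0 + q * T.size, ?_⟩
  rw [T.dist₀_add_mul_size, T.dist₀_zero, zero_add]
  exact (div_le_iff₀ h).1 hq

lemma pointIs_add_int_mul_length (T : Tour A) (q : ℤ) (x : ℝ) (s : P) :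
    T.PointIs (x + q * T.length) s ↔ T.PointIs x s := by
  refine exists_congr fun n => and_congr_right fun _ => or_congr_right ⟨?_, ?_⟩
  · rintro ⟨p, hp⟩
    exact ⟨p - q, by push_cast; linarith⟩
  · rintro ⟨p, rfl⟩
    exact ⟨p + q, by push_cast; ring⟩

lemma exists_robotSchedule_of_length_eq_zero (T : Tour A) (h : T.length = 0) :
    ∃ f : RobotSchedule P, ∀ x t s, 0 ≤ t → (f.IsAt t s ↔ T.PointIs (x + t) s) := by
  refine ⟨⟨fun _ => T.vertex 0, fun n => n, fun n => n + 1, by simp, by simp, by simp,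
    tendsto_natCast_atTop_atTop⟩, fun x t s ht => ⟨?_, ?_⟩⟩
  · rintro ⟨_, hs, -⟩
    exact ⟨0, hs, Or.inl h⟩
  · rintro ⟨n, hs, -⟩
    exact ⟨⌊t⌋₊, (T.vertex_eq_vertex_zero_of_length_eq_zero h n).symm.trans hs,
      Nat.floor_le ht, (Nat.lt_floor_add_one t).le⟩

lemma exists_robotSchedule_of_nonneg (T : Tour A) (hT : 0 < T.length) {x : ℝ} (hx : 0 ≤ x) :
    ∃ f : RobotSchedule P, ∀ t s, 0 ≤ t → (f.IsAt t s ↔ T.PointIs (x + t) s) := by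
  classical
  have hex : ∃ n, x ≤ T.dist₀ n := ((T.tendsto_dist₀ hT).eventually_ge_atTop x).exists
  set m := Nat.find hex
  have harrive : Tendsto (fun n => T.dist₀ (n + m) - x) atTop atTop :=
    tendsto_atTop_add_const_right _ _ ((T.tendsto_dist₀ hT).comp (tendsto_add_atTop_nat m))
  have hspeed : ∀ n, dist (T.vertex (n + m)) (T.vertex (n + 1 + m))
      ≤ T.dist₀ (n + 1 + m) - x - (T.dist₀ (n + m) - x) := fun n => by
    linarith [T.dist_vertex_le (show n + m ≤ n + 1 + m by omega)]
  refine ⟨⟨fun n => T.vertex (n + m), fun n => T.dist₀ (n + m) - x, fun n => T.dist₀ (n + m) - x,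
    by simpa using Nat.find_spec hex, fun _ => le_rfl, hspeed, harrive⟩,
    fun t s ht => ⟨?_, ?_⟩⟩
  · rintro ⟨n, hs, harr, hdep⟩
    exact ⟨n + m, hs, Or.inr ⟨0, by push_cast; linarith⟩⟩
  · rintro ⟨n, hs, hzero | ⟨q, hq⟩⟩
    · exact absurd hzero hT.ne'
    obtain ⟨l, hvertex, hdist⟩ := T.exists_dist₀_eq_add_int_mul_length n q (by linarith)
    have hml : m ≤ l := Nat.find_min' hex (by linarith)
    obtain ⟨p, rfl⟩ := Nat.exists_eq_add_of_le' hml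
    exact ⟨p, hvertex.trans hs, by linarith, by linarith⟩

lemma exists_robotSchedule (T : Tour A) (x : ℝ) :
    ∃ f : RobotSchedule P, ∀ t s, 0 ≤ t → (f.IsAt t s ↔ T.PointIs (x + t) s) := by
  rcases T.length_nonneg.eq_or_lt' with hzero | hpos
  · obtain ⟨f, hf⟩ := T.exists_robotSchedule_of_length_eq_zero hzero
    exact ⟨f, hf x⟩
  · obtain ⟨q, hq⟩ := exists_nat_ge (-x / T.length)
    have hx : 0 ≤ x + (q : ℤ) * T.length := by
      rw [div_le_iff₀ hpos] at hq
      push_cast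
      linarith
    obtain ⟨f, hf⟩ := T.exists_robotSchedule_of_nonneg hpos hx
    refine ⟨f, fun t s ht => (hf t s ht).trans ?_⟩
    rw [add_right_comm, T.pointIs_add_int_mul_length]

/-- The tour that visits the elements of `A` in the order of the enumeration `e`. -/
def ofEquiv {n : ℕ} [NeZero n] (e : Fin n ≃ A) : Tour A where
  size := n
  size_pos := NeZero.pos n
  vertex m := e (Fin.ofNat n m)
  periodic m := by
    congr 2
    ext
    simp
  bijOn := by
    refine ⟨fun m _ => (e _).2, fun l hl m hm h => ?_, fun a ha => ?_⟩
    · have := congrArg Fin.val (e.injective (Subtype.ext h))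
      rwa [Fin.val_ofNat, Fin.val_ofNat, Nat.mod_eq_of_lt hl, Nat.mod_eq_of_lt hm] at this
    · exact ⟨e.symm ⟨a, ha⟩, (e.symm ⟨a, ha⟩).2, by simp⟩

lemma length_ofEquiv {n : ℕ} (e : Fin (n + 1) ≃ A) :
    (ofEquiv e).length =
      ∑ i : Fin n, dist (e i.castSucc : P) (e i.succ) + dist (e (Fin.last n) : P) (e 0) := by
  have hvertex : ∀ i : Fin (n + 1), (ofEquiv e).vertex i = e i := fun i => by simp [ofEquiv]
  have hreturn : (ofEquiv e).vertex (n + 1) = e 0 := by simp [ofEquiv]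
  change (ofEquiv e).dist₀ (n + 1) = _
  rw [dist₀_succ, hreturn, dist₀,
    ← Fin.sum_univ_eq_sum_range fun i => dist ((ofEquiv e).vertex i) ((ofEquiv e).vertex (i + 1))]
  simp only [← hvertex, Fin.val_castSucc, Fin.val_succ, Fin.val_last]

end Tour

lemma exists_equiv_fin_monotone {α β : Type*} [LinearOrder β] {A : Set α} (hfin : A.Finite)
    (hA : A.Nonempty) (τ : α → β) :
    ∃ (n : ℕ) (e : Fin (n + 1) ≃ A), Monotone fun i => τ (e i) := by
  have := hfin.to_subtype
  have := hA.to_subtype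
  obtain ⟨n, hn⟩ := Nat.exists_eq_succ_of_ne_zero (Nat.card_pos (α := A)).ne'
  let e := (Finite.equivFinOfCardEq hn).symm
  exact ⟨n, (Tuple.sort fun i => τ (e i)).trans e, Tuple.monotone_sort fun i => τ (e i)⟩

namespace Tour

variable {P : Type*} [MetricSpace P] {A : Set P}

/-- Think of `τ` as positions on a circle of circumference `C`, in whose order `A` is visited. -/
lemma exists_length_le_of_dist_le (hfin : A.Finite) (hA : A.Nonempty) (τ : P → ℝ) {C : ℝ}
    (hforward : ∀ x ∈ A, ∀ y ∈ A, τ x ≤ τ y → dist x y ≤ τ y - τ x)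
    (hbackward : ∀ x ∈ A, ∀ y ∈ A, τ x ≤ τ y → dist x y ≤ C - (τ y - τ x)) :
    ∃ T : Tour A, T.length ≤ C := by
  obtain ⟨n, e, he⟩ := exists_equiv_fin_monotone hfin hA τ
  have hround : ∑ i : Fin n, dist (e i.castSucc : P) (e i.succ) ≤ τ (e (Fin.last n)) - τ (e 0) :=
    calc
      _ ≤ ∑ i : Fin n, (τ (e i.succ) - τ (e i.castSucc)) :=
        Finset.sum_le_sum fun i _ => hforward _ (e _).2 _ (e _).2 (he i.castSucc_le_succ)
      _ = _ := by
        rw [Finset.sum_sub_distrib]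
        linarith [Fin.sum_univ_succ fun i => τ (e i), Fin.sum_univ_castSucc fun i => τ (e i)]
  have hreturn := hbackward _ (e 0).2 _ (e (Fin.last n)).2 (he (Fin.zero_le _))
  refine ⟨ofEquiv e, ?_⟩
  rw [length_ofEquiv, dist_comm (e (Fin.last n) : P)]
  linarith

lemma finite_range_length (hfin : A.Finite) : (range (length : Tour A → ℝ)).Finite := by
  have := hfin.to_subtype
  refine (finite_range fun v : Fin (A.ncard + 1) → A =>
    ∑ i : Fin A.ncard, dist (v i.castSucc : P) (v i.succ)).subset ?_
  rintro _ ⟨T, rfl⟩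
  refine ⟨fun i => ⟨T.vertex i, T.vertex_mem i⟩, ?_⟩
  simp only [length, dist₀, Fin.val_castSucc, Fin.val_succ]
  rw [Fin.sum_univ_eq_sum_range fun i => dist (T.vertex i) (T.vertex (i + 1)), T.ncard_eq_size]

lemma exists_isTSP (hfin : A.Finite) (hA : A.Nonempty) : ∃ T : Tour A, T.IsTSP := by
  obtain ⟨_, e, -⟩ := exists_equiv_fin_monotone hfin hA fun _ => 0
  obtain ⟨_, ⟨T, rfl⟩, hT⟩ := exists_min_image _ id (finite_range_length hfin) ⟨_, ofEquiv e, rfl⟩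
  exact ⟨T, fun T' => hT _ ⟨T', rfl⟩⟩

end Tour

/-- The length of a travelling salesman tour of `A` (with the junk value `0` if `A` has no tour). -/
noncomputable def tspLength {P : Type*} [MetricSpace P] (A : Set P) : ℝ := ⨅ T : Tour A, T.length

section TspLength

variable {P : Type*} [MetricSpace P] {A : Set P}

lemma tspLength_nonneg (A : Set P) : 0 ≤ tspLength A := Real.iInf_nonneg Tour.length_nonneg

lemma tspLength_le (T : Tour A) : tspLength A ≤ T.length :=
  ciInf_le ⟨0, forall_mem_range.2 Tour.length_nonneg⟩ T

lemma Tour.IsTSP.length_eq {T : Tour A} (hT : T.IsTSP) : T.length = tspLength A :=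
  have : Nonempty (Tour A) := ⟨T⟩
  le_antisymm (le_ciInf hT) (tspLength_le T)

end TspLength

section Latency

variable {k : ℕ} {P : Type*} [MetricSpace P] {σ : PatrolSchedule k P}

lemma latency_le_ofReal {Λ : ℝ} (h : ∀ s c, 0 ≤ c → ∃ t ∈ Icc c (c + Λ), Visited σ s t) :
    latency σ ≤ ENNReal.ofReal Λ := by
  refine iSup_le fun s => iSup_le fun t₁ => iSup_le fun t₂ => iSup_le fun ht₁ => iSup_le fun _ =>
    iSup_le fun hgap => ENNReal.ofReal_le_ofReal ?_
  by_contra! hlt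
  -- The window of length `Λ` in the middle of a longer gap contains no visit.
  obtain ⟨t, ⟨hct, htc⟩, ht⟩ := h s ((t₁ + t₂ - Λ) / 2) (by linarith)
  exact hgap t (by linarith) (by linarith) ht

lemma sub_le_of_forall_not_visited {L : ℝ≥0} (hσ : latency σ ≤ L) {s : P} {a b : ℝ} (ha : 0 ≤ a)
    (hgap : ∀ t ∈ Ioo a b, ¬ Visited σ s t) : b - a ≤ L := by
  rcases le_or_gt b a with hba | hab
  · exact (sub_nonpos.2 hba).trans L.coe_nonneg
  have hsite : ENNReal.ofReal (b - a) ≤ siteLatency σ s :=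
    le_iSup_of_le a <| le_iSup_of_le b <| le_iSup_of_le ha <| le_iSup_of_le hab <|
      le_iSup_of_le (fun t hat htb => hgap t ⟨hat, htb⟩) le_rfl
  exact ENNReal.ofReal_le_coe.1 ((hsite.trans (le_iSup _ s)).trans hσ)

lemma exists_visited_mem_Ioo {L : ℝ≥0} (hσ : latency σ ≤ L) (s : P) {a b : ℝ} (ha : 0 ≤ a)
    (hab : a + L < b) : ∃ t ∈ Ioo a b, Visited σ s t := by
  by_contra! hgap
  linarith [sub_le_of_forall_not_visited hσ ha hgap]

end Latency

namespace CyclicPlan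

variable {k : ℕ} {P : Type*} [MetricSpace P]

/-- `σ` is a cyclic solution with the data `C`. -/
def IsRealizedBy (C : CyclicPlan k P) (σ : PatrolSchedule k P) : Prop :=
  ∀ (r : Fin k) (t : ℝ) (s : P), 0 ≤ t →
    ((σ r).IsAt t s ↔ (C.tour (C.team r)).PointIs (C.offset r + t) s)

lemma exists_isRealizedBy (C : CyclicPlan k P) : ∃ σ : PatrolSchedule k P, C.IsRealizedBy σ := by
  choose σ hσ using fun r => (C.tour (C.team r)).exists_robotSchedule (C.offset r)
  exact ⟨σ, hσ⟩

lemma teamSize_pos (C : CyclicPlan k P) (i : Fin C.numGroups) : 0 < C.teamSize i :=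
  (ncard_pos (toFinite _)).2 (C.team_surjective i)

lemma exists_index_modEq (C : CyclicPlan k P) (i : Fin C.numGroups) (m : ℤ) :
    ∃ r, C.team r = i ∧ (C.index r : ℤ) ≡ m [ZMOD C.teamSize i] := by
  have hpos : (0 : ℤ) < C.teamSize i := mod_cast C.teamSize_pos i
  obtain ⟨d, hd⟩ := Int.eq_ofNat_of_zero_le (Int.emod_nonneg m hpos.ne')
  obtain ⟨r, hr, hrd⟩ := (C.index_bijOn i).surjOn
    (show d ∈ Iio (C.teamSize i) by have := Int.emod_lt_of_pos m hpos; rw [mem_Iio]; omega)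
  exact ⟨r, hr, by rw [hrd, ← hd]; exact Int.mod_modEq m _⟩

lemma exists_pointIs_mem_Icc (C : CyclicPlan k P) (s : P) (c : ℝ) :
    ∃ r, ∃ t ∈ Icc c (c + (C.tour (C.group s)).length / C.teamSize (C.group s)),
      (C.tour (C.team r)).PointIs (C.offset r + t) s := by
  set i := C.group s with hi
  set T := C.tour i
  set gap := T.length / C.teamSize i
  have hK : (0 : ℝ) < C.teamSize i := mod_cast C.teamSize_pos i
  obtain ⟨n, -, hn⟩ := T.bijOn.surjOn hi.symm
  rcases T.length_nonneg.eq_or_lt' with hzero | hpos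
  · obtain ⟨r, hr⟩ := C.team_surjective i
    exact ⟨r, c, ⟨le_rfl, by simp [gap, hzero]⟩, hr ▸ ⟨n, hn, Or.inl hzero⟩⟩
  -- Robot number `0` or one of its translates by `m` gaps is at `s` in each window of one gap.
  obtain ⟨m, ⟨hcm, hmc⟩, -⟩ :=
    existsUnique_add_zsmul_mem_Ico (div_pos hpos hK) (T.dist₀ n - C.start i) c
  obtain ⟨r, hr, hmod⟩ := C.exists_index_modEq i (-m)
  obtain ⟨q, hq⟩ := Int.modEq_iff_dvd.1 hmod
  have hindex : (C.index r : ℝ) + m = -q * C.teamSize i := by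
    have : (-m - C.index r : ℝ) = C.teamSize i * q := mod_cast hq
    linarith
  refine ⟨r, _, ⟨hcm, hmc.le⟩, ?_⟩
  rw [offset, hr]
  refine ⟨n, hn, Or.inr ⟨-q, ?_⟩⟩
  rw [zsmul_eq_mul]
  calc
    _ = T.dist₀ n + (C.index r + m) * gap := by ring
    _ = T.dist₀ n + -q * (C.teamSize i * gap) := by rw [hindex]; ring
    _ = _ := by rw [mul_div_cancel₀ _ hK.ne']; push_cast; rfl

lemma IsRealizedBy.latency_le {C : CyclicPlan k P} {σ : PatrolSchedule k P}
    (hσ : C.IsRealizedBy σ) {Λ : ℝ} (hΛ : ∀ i, (C.tour i).length / C.teamSize i ≤ Λ) :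
    latency σ ≤ ENNReal.ofReal Λ :=
  latency_le_ofReal fun s c hc => by
    obtain ⟨r, t, ⟨hct, htc⟩, ht⟩ := C.exists_pointIs_mem_Icc s c
    exact ⟨t, ⟨hct, htc.trans (by gcongr; exact hΛ _)⟩, r, (hσ r t s (hc.trans hct)).2 ht⟩

end CyclicPlan

lemma exists_bijOn_Iio_ncard {ι κ : Type*} [Finite ι] (f : ι → κ) :
    ∃ index : ι → ℕ, ∀ c, BijOn index {r | f r = c} (Iio {r | f r = c}.ncard) := by
  have hfiber : ∀ c, ∃ e : ι → ℕ, BijOn e {r | f r = c} (Iio {r | f r = c}.ncard) := fun c => by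
    refine (toFinite _).exists_bijOn_of_encard_eq ?_
    rw [← (toFinite _).cast_ncard_eq, ← (finite_Iio _).cast_ncard_eq, ncard_Iio_nat]
  choose e he using hfiber
  exact ⟨fun r => e (f r) r, fun c => (he c).congr fun r hr => by rw [← hr.out]⟩

open Classical in
/-- The latency of the best cyclic solution for two robots with the groups `A` and `Aᶜ`, or with a
single group if one of these sets is empty. -/
noncomputable def cyclicLatency {P : Type*} [MetricSpace P] (A : Set P) : ℝ :=
  if A.Nonempty ∧ Aᶜ.Nonempty then max (tspLength A) (tspLength Aᶜ)
  else tspLength (univ : Set P) / 2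

section CyclicLatency

variable {P : Type*} [MetricSpace P] {A : Set P}

lemma cyclicLatency_empty : cyclicLatency (∅ : Set P) = tspLength (univ : Set P) / 2 := by
  simp [cyclicLatency]

lemma cyclicLatency_le [Nonempty P] {L : ℝ} (hA : A.Nonempty → tspLength A ≤ L)
    (hA' : Aᶜ.Nonempty → tspLength Aᶜ ≤ L) : cyclicLatency A ≤ L := by
  unfold cyclicLatency
  split_ifs with h
  · exact max_le (hA h.1) (hA' h.2)
  refine (half_le_self (tspLength_nonneg _)).trans ?_
  rcases not_and_or.1 h with hempty | hempty <;> rw [not_nonempty_iff_eq_empty] at hempty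
  · simpa [hempty] using hA'
  · simpa [compl_empty_iff.1 hempty] using hA

end CyclicLatency

section CyclicSolutions

variable {P : Type*} [MetricSpace P] [Finite P]

lemma exists_isCyclic_latency_le {k m : ℕ} {group : P → Fin m}
    (hgroup : Function.Surjective group) {team : Fin k → Fin m}
    (hteam : Function.Surjective team) {Λ : ℝ}
    (hΛ : ∀ i, tspLength {s | group s = i} / {r | team r = i}.ncard ≤ Λ) :
    ∃ σ : PatrolSchedule k P, IsCyclic σ ∧ latency σ ≤ ENNReal.ofReal Λ := by
  choose T hT using fun i => Tour.exists_isTSP (toFinite {s | group s = i}) (hgroup i)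
  obtain ⟨index, hindex⟩ := exists_bijOn_Iio_ncard team
  let C : CyclicPlan k P := ⟨m, group, hgroup, team, hteam, T, hT, index, hindex, fun _ => 0⟩
  obtain ⟨σ, hσ⟩ := C.exists_isRealizedBy
  exact ⟨σ, ⟨C, hσ⟩, hσ.latency_le fun i => (hT i).length_eq ▸ hΛ i⟩

lemma exists_isCyclic_latency_le_tspLength_univ_div [Nonempty P] {k : ℕ} [NeZero k] :
    ∃ σ : PatrolSchedule k P,
      IsCyclic σ ∧ latency σ ≤ ENNReal.ofReal (tspLength (univ : Set P) / k) := by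
  refine exists_isCyclic_latency_le (group := fun _ => (0 : Fin 1)) (team := fun _ => 0)
    (Function.surjective_to_subsingleton _) (Function.surjective_to_subsingleton _) fun i => ?_
  simp [Subsingleton.elim i 0, ncard_univ]

lemma exists_isCyclic_latency_le_max_tspLength {A : Set P} (hA : A.Nonempty) (hA' : Aᶜ.Nonempty) :
    ∃ σ : PatrolSchedule 2 P,
      IsCyclic σ ∧ latency σ ≤ ENNReal.ofReal (max (tspLength A) (tspLength Aᶜ)) := by
  classical
  obtain ⟨a, ha⟩ := hA
  obtain ⟨b, hb⟩ := hA'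
  refine exists_isCyclic_latency_le (group := fun s => if s ∈ A then (0 : Fin 2) else 1)
    (Fin.forall_fin_two.2 ⟨⟨a, if_pos ha⟩, ⟨b, if_neg hb⟩⟩) (team := id)
    Function.surjective_id (Fin.forall_fin_two.2 ⟨?_, ?_⟩)
  · simp
  · simp [← compl_def]

lemma exists_isCyclic_latency_le_cyclicLatency [Nonempty P] (A : Set P) :
    ∃ σ : PatrolSchedule 2 P, IsCyclic σ ∧ latency σ ≤ ENNReal.ofReal (cyclicLatency A) := by
  unfold cyclicLatency
  split_ifs with h
  · exact exists_isCyclic_latency_le_max_tspLength h.1 h.2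
  · exact exists_isCyclic_latency_le_tspLength_univ_div

end CyclicSolutions

section StableMatching

variable {ι α β : Type*}

/-- One element `(l i, r (π i))` of each `G i (π i)` is chosen in such a way that every element `g`
of every `G i j` satisfies `l i ≤ g.1` or `g.2 ≤ r j`. These are the stable matchings of the left
indices with the right indices in which each left index wants a small first component and each right
index a large second component, and in which each `g ∈ G i j` is a possible contract of `i` and `j`:
the inequalities say that `i` and `j` do not both prefer `g` strictly to their own contracts. -/
def IsStableMatching [LE α] [LE β] (G : ι → ι → Set (α × β)) (π : Equiv.Perm ι) (l : ι → α)
    (r : ι → β) : Prop :=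
  (∀ i, (l i, r (π i)) ∈ G i (π i)) ∧ ∀ i j, ∀ g ∈ G i j, l i ≤ g.1 ∨ g.2 ≤ r j

lemma IsStableMatching.trans_right [LE α] [LE β] {G : ι → ι → Set (α × β)} {π : Equiv.Perm ι}
    {l : ι → α} {r : ι → β} (e : Equiv.Perm ι)
    (h : IsStableMatching (fun i j => G i (e j)) π l r) :
    IsStableMatching G (π.trans e) l (r ∘ e.symm) := by
  refine ⟨fun i => by simpa using h.1 i, fun i j g hg => ?_⟩
  exact h.2 i (e.symm j) g (by simpa using hg)

variable [LinearOrder α] [TopologicalSpace α] [OrderClosedTopology α] [TopologicalSpace β]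

lemma exists_forall_fst_le {K : Set (α × β)} (hK : IsCompact K) (hne : K.Nonempty) :
    ∃ g ∈ K, ∀ g' ∈ K, g.1 ≤ g'.1 :=
  hK.exists_isMinOn hne continuous_fst.continuousOn

variable [LinearOrder β] [OrderClosedTopology β]

lemma exists_forall_snd_le_of_fst_le {K : Set (α × β)} (hK : IsCompact K) {g₀ : α × β}
    (hg₀ : g₀ ∈ K) {c : α} (hc : g₀.1 ≤ c) :
    ∃ g ∈ K, g.1 ≤ c ∧ ∀ g' ∈ K, g'.1 ≤ c → g'.2 ≤ g.2 := by
  obtain ⟨g, ⟨hgK, hgc⟩, hmax⟩ :=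
    (hK.inter_right (isClosed_le continuous_fst (continuous_const (y := c)))).exists_isMaxOn
      ⟨g₀, hg₀, hc⟩ continuous_snd.continuousOn
  exact ⟨g, hgK, hgc, fun g' hg' hg'c => hmax ⟨hg', hg'c⟩⟩

lemma exists_isStableMatching_of_forall_le {G : Fin 2 → Fin 2 → Set (α × β)}
    (hG : ∀ i j, IsCompact (G i j)) {s₀ : α × β} (hs₀ : s₀ ∈ G 0 0) (h01 : (G 0 1).Nonempty)
    (h11 : (G 1 1).Nonempty) (hle : ∀ g ∈ G 0 1, s₀.1 ≤ g.1) :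
    ∃ π l r, IsStableMatching G π l r := by
  obtain ⟨z, hz, hzmin⟩ := exists_forall_fst_le (hG 0 1) h01
  obtain ⟨p, hp, hpmin⟩ := exists_forall_fst_le (hG 1 1) h11
  obtain ⟨s, hs, hsz, hsmax⟩ := exists_forall_snd_le_of_fst_le (hG 0 0) hs₀ (hle z hz)
  by_cases hstable : ∀ g ∈ G 1 0, p.1 ≤ g.1 ∨ g.2 ≤ s.2
  · refine ⟨1, ![s.1, p.1], ![s.2, p.2], Fin.forall_fin_two.2 ⟨hs, hp⟩,
      Fin.forall_fin_two.2 ⟨Fin.forall_fin_two.2 ⟨fun g hg => ?_, fun g hg => ?_⟩,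
        Fin.forall_fin_two.2 ⟨hstable, fun g hg => Or.inl (hpmin g hg)⟩⟩⟩
    · exact (le_total s.1 g.1).imp_right fun h => hsmax g hg (h.trans hsz)
    · exact Or.inl (hsz.trans (hzmin g hg))
  -- If `1` and `0` prefer a contract in `G 1 0`, then the left index `0` has to fall back to `z`.
  · push Not at hstable
    obtain ⟨w₀, hw₀, hw₀p, hsw₀⟩ := hstable
    obtain ⟨w, hw, hwp, hwmax⟩ := exists_forall_snd_le_of_fst_le (hG 1 0) hw₀ hw₀p.le
    have hsw : s.2 ≤ w.2 := hsw₀.le.trans (hwmax w₀ hw₀ hw₀p.le)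
    refine ⟨Equiv.swap 0 1, ![z.1, w.1], ![w.2, z.2], Fin.forall_fin_two.2 ⟨hz, hw⟩,
      Fin.forall_fin_two.2 ⟨Fin.forall_fin_two.2 ⟨fun g hg => ?_, fun g hg => ?_⟩,
        Fin.forall_fin_two.2 ⟨fun g hg => ?_, fun g hg => ?_⟩⟩⟩
    · exact (le_total z.1 g.1).imp_right fun h => (hsmax g hg h).trans hsw
    · exact Or.inl (hzmin g hg)
    · exact (le_total w.1 g.1).imp_right fun h => hwmax g hg (h.trans hwp)
    · exact Or.inl (hwp.trans (hpmin g hg))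

lemma exists_isStableMatching {G : Fin 2 → Fin 2 → Set (α × β)} (hG : ∀ i j, IsCompact (G i j))
    (hdiag : ∀ i, (G i i).Nonempty) (hoff : (G 0 1).Nonempty ↔ (G 1 0).Nonempty) :
    ∃ π l r, IsStableMatching G π l r := by
  obtain ⟨s, hs, hsmin⟩ := exists_forall_fst_le (hG 0 0) (hdiag 0)
  by_cases h01 : (G 0 1).Nonempty
  · obtain ⟨z, hz, hzmin⟩ := exists_forall_fst_le (hG 0 1) h01
    rcases le_total s.1 z.1 with hsz | hzs
    · exact exists_isStableMatching_of_forall_le hG hs h01 (hdiag 1)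
        fun g hg => hsz.trans (hzmin g hg)
    · obtain ⟨π, l, r, h⟩ :=
        exists_isStableMatching_of_forall_le (G := fun i j => G i (Equiv.swap 0 1 j))
          (fun i j => hG i _) hz (hdiag 0) (hoff.1 h01) fun g hg => hzs.trans (hsmin g hg)
      exact ⟨_, l, _, h.trans_right _⟩
  · obtain ⟨p, hp, hpmin⟩ := exists_forall_fst_le (hG 1 1) (hdiag 1)
    refine ⟨1, ![s.1, p.1], ![s.2, p.2], Fin.forall_fin_two.2 ⟨hs, hp⟩,
      Fin.forall_fin_two.2 ⟨Fin.forall_fin_two.2 ⟨fun g hg => ?_, fun g hg => ?_⟩,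
        Fin.forall_fin_two.2 ⟨fun g hg => ?_, fun g hg => ?_⟩⟩⟩
    · exact Or.inl (hsmin g hg)
    · exact absurd ⟨g, hg⟩ h01
    · exact absurd ⟨g, hg⟩ (hoff.not.1 h01)
    · exact Or.inl (hpmin g hg)

end StableMatching

lemma exists_gap {U V : Set ℝ} (hU : IsClosed U) (hV : IsClosed V) {u v : ℝ} (hu : u ∈ U)
    (hv : v ∈ V) (huv : u ≤ v) :
    ∃ u' ∈ U, ∃ v' ∈ V, u ≤ u' ∧ u' ≤ v' ∧ v' ≤ v ∧ ∀ t ∈ Ioo u' v', t ∉ U ∧ t ∉ V := by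
  obtain ⟨u', ⟨hu', huu', hu'v⟩, hmax⟩ :=
    (isCompact_Icc.inter_left hU).exists_isGreatest ⟨u, hu, left_mem_Icc.2 huv⟩
  obtain ⟨v', ⟨hv', hu'v', hv'v⟩, hmin⟩ :=
    (isCompact_Icc.inter_left hV).exists_isLeast ⟨v, hv, right_mem_Icc.2 hu'v⟩
  refine ⟨u', hu', v', hv', huu', hu'v', hv'v, fun t ⟨hut, htv⟩ => ⟨fun ht => ?_, fun ht => ?_⟩⟩
  · exact hut.not_ge (hmax ⟨ht, huu'.trans hut.le, htv.le.trans hv'v⟩)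
  · exact htv.not_ge (hmin ⟨ht, hut.le, htv.le.trans hv'v⟩)

section UnitSpeed

variable {P : Type*} [MetricSpace P]

/-- `W t s`, read as "at time `t` the traveller is at `s`", describes the known positions of a
traveller of maximum speed `1`. Between these positions, nothing is said about the traveller. -/
def IsUnitSpeed (W : ℝ → P → Prop) : Prop :=
  ∀ ⦃u v s s'⦄, u ≤ v → W u s → W v s' → dist s s' ≤ v - u

lemma RobotSchedule.dist_site_le (f : RobotSchedule P) {m n : ℕ} (h : m < n) :
    dist (f.site m) (f.site n) ≤ f.arrive n - f.depart m := by
  induction n, h using Nat.le_induction with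
  | base => exact f.speed_le_one m
  | succ n _ ih =>
    linarith [dist_triangle (f.site m) (f.site n) (f.site (n + 1)), f.speed_le_one n,
      f.arrive_le_depart n]

lemma RobotSchedule.isUnitSpeed_isAt (f : RobotSchedule P) : IsUnitSpeed f.IsAt := by
  rintro u v _ _ huv ⟨m, rfl, hm, hm'⟩ ⟨n, rfl, hn, hn'⟩
  rcases lt_trichotomy m n with h | rfl | h
  · linarith [f.dist_site_le h]
  · simpa using huv
  · rw [dist_comm]
    linarith [f.dist_site_le h]

lemma IsUnitSpeed.concat {W W' : ℝ → P → Prop} (hW : IsUnitSpeed W) (hW' : IsUnitSpeed W')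
    {b a' : ℝ} {w : P} (hw : W b w) (hw' : W' a' w) :
    IsUnitSpeed fun t x => (t ≤ b ∧ W t x) ∨ (b ≤ t ∧ W' (t - b + a') x) := by
  rintro u v x y huv (⟨hub, hx⟩ | ⟨hbu, hx⟩) (⟨hvb, hy⟩ | ⟨hbv, hy⟩)
  · exact hW huv hx hy
  · linarith [dist_triangle x w y, hW hub hx hw, hW' (by linarith) hw' hy]
  · obtain ⟨rfl, rfl⟩ : u = b ∧ v = b := ⟨by linarith, by linarith⟩
    linarith [dist_triangle x w y, dist_comm w x, dist_comm w y, hW le_rfl hy hw,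
      hW' (by linarith) hw' hx]
  · linarith [hW' (by linarith) hx hy]

lemma IsUnitSpeed.exists_tour_length_le {W : ℝ → P → Prop} (hW : IsUnitSpeed W) {A : Set P}
    (hfin : A.Finite) (hA : A.Nonempty) {a b : ℝ} (hloop : a = b ∨ ∃ z, W a z ∧ W b z)
    (hAW : ∀ x ∈ A, ∃ t ∈ Icc a b, W t x) : ∃ T : Tour A, T.length ≤ b - a := by
  obtain ⟨z, hza, hzb⟩ : ∃ z, W a z ∧ W b z := hloop.elim (fun hab => by
    obtain ⟨x, hx⟩ := hA
    obtain ⟨t, ht, htx⟩ := hAW x hx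
    obtain rfl : t = a := by linarith [ht.1, ht.2]
    exact ⟨x, htx, hab ▸ htx⟩) id
  choose! τ hτ hτW using hAW
  refine Tour.exists_length_le_of_dist_le hfin hA τ
    (fun x hx y hy hxy => hW hxy (hτW x hx) (hτW y hy)) fun x hx y hy _ => ?_
  rw [dist_comm]
  linarith [dist_triangle y z x, hW (hτ x hx).1 hza (hτW x hx), hW (hτ y hy).2 (hτW y hy) hzb]

lemma IsUnitSpeed.tspLength_le {W : ℝ → P → Prop} (hW : IsUnitSpeed W) {A : Set P}
    (hfin : A.Finite) (hA : A.Nonempty) {a b : ℝ} (hloop : a = b ∨ ∃ z, W a z ∧ W b z)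
    (hAW : ∀ x ∈ A, ∃ t ∈ Icc a b, W t x) : tspLength A ≤ b - a := by
  obtain ⟨T, hT⟩ := hW.exists_tour_length_le hfin hA hloop hAW
  exact (Patrol.tspLength_le T).trans hT

lemma IsUnitSpeed.tspLength_le_of_exchange {W W' : ℝ → P → Prop} (hW : IsUnitSpeed W)
    (hW' : IsUnitSpeed W') {A : Set P} (hfin : A.Finite) (hA : A.Nonempty) {a b a' b' : ℝ}
    (hab : a ≤ b) (hab' : a' ≤ b') {z w : P} (hz : W a z) (hz' : W' b' z) (hw : W b w)
    (hw' : W' a' w) (hAW : ∀ x ∈ A, (∃ t ∈ Icc a b, W t x) ∨ ∃ t ∈ Icc a' b', W' t x) :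
    tspLength A ≤ (b - a) + (b' - a') := by
  refine ((hW.concat hW' hw hw').tspLength_le hfin hA (a := a) (b := b + (b' - a'))
    (Or.inr ⟨z, Or.inl ⟨hab, hz⟩, Or.inr ⟨by linarith, by simpa using hz'⟩⟩)
    fun x hx => ?_).trans_eq (by ring)
  rcases hAW x hx with ⟨t, ⟨hat, htb⟩, htx⟩ | ⟨t, ⟨hat, htb⟩, htx⟩
  · exact ⟨t, ⟨hat, by linarith⟩, Or.inl ⟨htb, htx⟩⟩
  · exact ⟨t - a' + b, ⟨by linarith, by linarith⟩, Or.inr ⟨by linarith, by simpa using htx⟩⟩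

end UnitSpeed

section Closed

variable {k : ℕ} {P : Type*} [MetricSpace P]

lemma RobotSchedule.isClosed_isAt (f : RobotSchedule P) (s : P) : IsClosed {t | f.IsAt t s} := by
  have hlocal : LocallyFinite fun n => Icc (f.arrive n) (f.depart n) := fun x => by
    refine ⟨Iio (x + 1), Iio_mem_nhds (lt_add_one x), ?_⟩
    have h := f.tendsto_arrive.eventually_ge_atTop (x + 1)
    rw [← Nat.cofinite_eq_atTop] at h
    refine h.subset ?_
    rintro n ⟨t, ⟨hnt, -⟩, htx⟩ hxn
    exact htx.not_ge (hxn.trans hnt)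
  have hunion : {t | f.IsAt t s} =
      ⋃ n : {n // f.site n = s}, Icc (f.arrive n) (f.depart n) := by
    ext t
    simp only [RobotSchedule.IsAt, mem_iUnion, Subtype.exists, exists_prop]
    rfl
  rw [hunion]
  exact (hlocal.comp_injective Subtype.val_injective).isClosed_iUnion fun _ => isClosed_Icc

lemma isClosed_visited (σ : PatrolSchedule k P) (s : P) : IsClosed {t | Visited σ s t} := by
  simp only [Visited, ofPred_exists]
  exact isClosed_iUnion_of_finite fun r => (σ r).isClosed_isAt s

end Closed

section Links

variable {k : ℕ} {P : Type*} [MetricSpace P] {σ : PatrolSchedule k P} {L : ℝ}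

/-- The time intervals `(u, v)` of length at most `L` such that robot `j` is at time `v` at the site
where robot `i` was at time `u`. If `i = j` and `u = v`, this position need not be a site.
Pairs with `v < u` are not excluded. -/
def links (σ : PatrolSchedule k P) (L : ℝ) (i j : Fin k) : Set (ℝ × ℝ) :=
  {g | g.2 ≤ g.1 + L ∧
    ((i = j ∧ g.1 = g.2) ∨ ∃ s, (σ i).IsAt g.1 s ∧ (σ j).IsAt g.2 s)}

/-- The links from robot `i` to robot `j` whose time interval contains `t`. -/
def linksAt (σ : PatrolSchedule k P) (L t : ℝ) (i j : Fin k) : Set (ℝ × ℝ) :=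
  {g ∈ links σ L i j | g.1 ≤ t ∧ t ≤ g.2}

lemma self_mem_linksAt (hL : 0 ≤ L) (t : ℝ) (i : Fin k) : (t, t) ∈ linksAt σ L t i i :=
  ⟨⟨le_add_of_nonneg_right hL, Or.inl ⟨rfl, rfl⟩⟩, le_rfl, le_rfl⟩

section Finite

variable [Finite P]

lemma isClosed_links (σ : PatrolSchedule k P) (L : ℝ) (i j : Fin k) :
    IsClosed (links σ L i j) := by
  have hself : IsClosed {g : ℝ × ℝ | i = j ∧ g.1 = g.2} :=
    isClosed_const.and (isClosed_eq continuous_fst continuous_snd)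
  have hsite : IsClosed {g : ℝ × ℝ | ∃ s, (σ i).IsAt g.1 s ∧ (σ j).IsAt g.2 s} := by
    simp only [ofPred_exists]
    exact isClosed_iUnion_of_finite fun s =>
      (((σ i).isClosed_isAt s).preimage continuous_fst).inter
        (((σ j).isClosed_isAt s).preimage continuous_snd)
  exact (isClosed_le continuous_snd (continuous_fst.add_const L)).inter (hself.union hsite)

lemma isCompact_linksAt (σ : PatrolSchedule k P) (L t : ℝ) (i j : Fin k) :
    IsCompact (linksAt σ L t i j) := by
  refine (isCompact_Icc.prod isCompact_Icc).of_isClosed_subset (s := Icc (t - L) t ×ˢ Icc t (t + L))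
    ((isClosed_links σ L i j).inter (isClosed_Iic.prod (isClosed_Ici (a := t)))) ?_
  rintro ⟨u, v⟩ ⟨⟨hvu, -⟩, hut, htv⟩
  exact ⟨⟨by linarith, hut⟩, htv, by linarith⟩

open Pointwise in
lemma isClosed_nonempty_linksAt (σ : PatrolSchedule k P) (L : ℝ) (i j : Fin k) :
    IsClosed {t | (linksAt σ L t i j).Nonempty} := by
  have hsum : {t | (linksAt σ L t i j).Nonempty} =
      (fun t => (t, t)) ⁻¹' (links σ L i j + Icc 0 L ×ˢ Icc (-L) 0) := by
    ext t
    constructor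
    · rintro ⟨⟨u, v⟩, hlink, hut, htv⟩
      have hvu := hlink.1
      exact ⟨(u, v), hlink, (t - u, t - v),
        ⟨⟨by linarith, by linarith⟩, by linarith, by linarith⟩, by simp⟩
    · rintro ⟨⟨u, v⟩, hlink, ⟨c, d⟩, ⟨hc, hd⟩, hcd⟩
      obtain ⟨huc, hvd⟩ := Prod.mk.inj hcd
      simp only at huc hvd hc hd
      exact ⟨(u, v), hlink, by simp only; linarith [hc.1], by simp only; linarith [hd.2]⟩
  rw [hsum]
  exact ((isClosed_links σ L i j).add_right_of_isCompact
    (isCompact_Icc.prod isCompact_Icc)).preimage (by fun_prop)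

end Finite

end Links

section Handovers

variable {k : ℕ} {P : Type*} [MetricSpace P] {σ : PatrolSchedule k P} {L : ℝ≥0}

lemma exists_linksAt_isAt (hσ : latency σ ≤ L) {t : ℝ} (ht : L < t) (s : P) :
    ∃ i j, ∃ g ∈ linksAt σ L t i j, (σ i).IsAt g.1 s ∧ (σ j).IsAt g.2 s := by
  obtain ⟨u₀, ⟨hu₀, hu₀t⟩, hu₀s⟩ := exists_visited_mem_Ioo hσ s le_rfl (by linarith : 0 + L < t)
  obtain ⟨v₀, ⟨htv₀, -⟩, hv₀s⟩ :=
    exists_visited_mem_Ioo hσ s (L.coe_nonneg.trans ht.le) (lt_add_one (t + L))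
  have hclosed := isClosed_visited σ s
  obtain ⟨u, ⟨⟨i, hi⟩, hut⟩, v, ⟨⟨j, hj⟩, htv⟩, hu₀u, -, -, hgap⟩ :=
    exists_gap (hclosed.inter isClosed_Iic) (hclosed.inter isClosed_Ici) ⟨hu₀s, hu₀t.le⟩
      ⟨hv₀s, htv₀.le⟩ (hu₀t.trans htv₀).le
  have hvu : v - u ≤ L := sub_le_of_forall_not_visited hσ (hu₀.le.trans hu₀u) fun w hw hvis =>
    (le_total w t).elim (fun h => (hgap w hw).1 ⟨hvis, h⟩) fun h => (hgap w hw).2 ⟨hvis, h⟩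
  exact ⟨i, j, (u, v), ⟨⟨by linarith, Or.inr ⟨s, hi, hj⟩⟩, hut, htv⟩, hi, hj⟩

lemma exists_nonempty_linksAt_of_isAt {σ : PatrolSchedule 2 P} (hσ : latency σ ≤ L) {i j : Fin 2}
    (hij : i ≠ j) {s : P} {u v : ℝ} (hu : 0 ≤ u) (huv : u ≤ v) (hi : (σ i).IsAt u s)
    (hj : (σ j).IsAt v s) : ∃ t ≥ u, (linksAt σ L t i j).Nonempty := by
  obtain ⟨u', hi', v', hj', huu', huv', -, hgap⟩ :=
    exists_gap ((σ i).isClosed_isAt s) ((σ j).isClosed_isAt s) hi hj huv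
  have hL : v' - u' ≤ L := sub_le_of_forall_not_visited hσ (hu.trans huu') fun w hw hvis => by
    obtain ⟨r, hr⟩ := hvis
    obtain rfl | rfl : r = i ∨ r = j := by omega
    exacts [(hgap w hw).1 hr, (hgap w hw).2 hr]
  exact ⟨u', huu', (u', v'), ⟨by linarith, Or.inr ⟨s, hi', hj'⟩⟩, le_rfl, huv'⟩

variable [Finite P] {σ : PatrolSchedule 2 P}

lemma exists_nonempty_linksAt_swap (hσ : latency σ ≤ L) {i j : Fin 2} (hij : i ≠ j)
    (hall : ∀ t : ℝ, L < t → (linksAt σ L t j i).Nonempty) :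
    ∃ t : ℝ, L < t ∧ (linksAt σ L t i j).Nonempty := by
  let time (n : ℕ) : ℝ := L + 1 + n * (2 * L + 1)
  have htime : ∀ n, L < time n := fun n => by
    simp only [time]
    nlinarith [L.coe_nonneg, n.cast_nonneg (α := ℝ)]
  have hsite : ∀ n, ∃ s, ∃ g ∈ linksAt σ L (time n) j i,
      (σ j).IsAt g.1 s ∧ (σ i).IsAt g.2 s := fun n => by
    obtain ⟨g, hg⟩ := hall _ (htime n)
    obtain ⟨s, hs⟩ := hg.1.2.resolve_left fun h => hij h.1.symm
    exact ⟨s, g, hg, hs⟩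
  choose s g hg hjs his using hsite
  obtain ⟨m, n, hmn, hs⟩ := Finite.exists_ne_map_eq_of_infinite s
  wlog hlt : m < n generalizing m n
  · exact this n m hmn.symm hs.symm (by omega)
  have hstep : time m + (2 * L + 1) ≤ time n := by
    have : (m + 1 : ℝ) ≤ n := mod_cast hlt
    simp only [time]
    nlinarith [L.coe_nonneg]
  obtain ⟨⟨hvm, -⟩, hum, hmv⟩ := hg m
  obtain ⟨⟨hvn, -⟩, -, hnv⟩ := hg n
  have htm := htime m
  obtain ⟨t, ht, hne⟩ := exists_nonempty_linksAt_of_isAt hσ hij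
    (by linarith [L.coe_nonneg]) (by linarith : (g m).2 ≤ (g n).1) (his m) (hs ▸ hjs n)
  exact ⟨t, by linarith, hne⟩

lemma exists_nonempty_linksAt_iff (hσ : latency σ ≤ L) :
    ∃ t : ℝ, L < t ∧ ((linksAt σ L t 0 1).Nonempty ↔ (linksAt σ L t 1 0).Nonempty) := by
  by_contra hcontra
  have hxor : ∀ t : ℝ, L < t →
      ¬((linksAt σ L t 0 1).Nonempty ↔ (linksAt σ L t 1 0).Nonempty) :=
    fun t ht h => hcontra ⟨t, ht, h⟩
  have hor : ∀ t : ℝ, L < t → (linksAt σ L t 0 1).Nonempty ∨ (linksAt σ L t 1 0).Nonempty :=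
    fun t ht => by have := hxor t ht; tauto
  have hex : ∀ i j : Fin 2, i ≠ j →
      (∀ t : ℝ, L < t → (linksAt σ L t i j).Nonempty ∨ (linksAt σ L t j i).Nonempty) →
        ∃ t : ℝ, L < t ∧ (linksAt σ L t i j).Nonempty := fun i j hij h => by
    by_contra hnone
    exact hnone <| exists_nonempty_linksAt_swap hσ hij fun t ht =>
      (h t ht).resolve_left fun hne => hnone ⟨t, ht, hne⟩
  obtain ⟨t, ht, h01, h10⟩ := isPreconnected_closed_iff.1 isPreconnected_Ioi _ _
    (isClosed_nonempty_linksAt σ L 0 1) (isClosed_nonempty_linksAt σ L 1 0) hor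
    (hex 0 1 (by decide) hor) (hex 1 0 (by decide) fun t ht => (hor t ht).symm)
  exact hxor t ht (iff_of_true h01 h10)

end Handovers

section LowerBound

variable {P : Type*} [MetricSpace P] {σ : PatrolSchedule 2 P} {L : ℝ≥0} {t : ℝ}
  {π : Equiv.Perm (Fin 2)} {l r : Fin 2 → ℝ}

lemma IsStableMatching.exists_isAt (hσ : latency σ ≤ L) (ht : L < t)
    (h : IsStableMatching (linksAt σ L t) π l r) (s : P) :
    ∃ i, ∃ τ ∈ Icc (l i) (r i), (σ i).IsAt τ s := by
  have hl : ∀ i, l i ≤ t := fun i => (h.1 i).2.1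
  have hr : ∀ j, t ≤ r j := fun j => by simpa using (h.1 (π.symm j)).2.2
  obtain ⟨i, j, g, hg, hi, hj⟩ := exists_linksAt_isAt hσ ht s
  rcases h.2 i j g hg with hlg | hgr
  · exact ⟨i, g.1, ⟨hlg, hg.2.1.trans (hr i)⟩, hi⟩
  · exact ⟨j, g.2, ⟨(hl j).trans hg.2.2, hgr⟩, hj⟩

variable [Finite P] [Nonempty P]

lemma exists_cyclicLatency_le_of_isStableMatching_one (hσ : latency σ ≤ L) (ht : L < t)
    (h : IsStableMatching (linksAt σ L t) 1 l r) : ∃ A : Set P, cyclicLatency A ≤ L := by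
  let A (i : Fin 2) : Set P := {s | ∃ τ ∈ Icc (l i) (r i), (σ i).IsAt τ s}
  have hloop : ∀ i, ∀ B ⊆ A i, B.Nonempty → tspLength B ≤ L := fun i B hB hne => by
    obtain ⟨⟨hlen, hclosed⟩, -⟩ := h.1 i
    linarith [(σ i).isUnitSpeed_isAt.tspLength_le (toFinite B) hne (hclosed.imp_left And.right) hB]
  have hcompl : (A 0)ᶜ ⊆ A 1 := fun s hs =>
    (Fin.exists_fin_two.1 (h.exists_isAt hσ ht s)).resolve_left hs
  exact ⟨A 0, cyclicLatency_le (hloop 0 _ subset_rfl) (hloop 1 _ hcompl)⟩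

lemma tspLength_univ_le_of_isStableMatching_swap (hσ : latency σ ≤ L) (ht : L < t)
    (h : IsStableMatching (linksAt σ L t) (Equiv.swap 0 1) l r) :
    tspLength (univ : Set P) ≤ 2 * L := by
  have h0 := h.1 0
  have h1 := h.1 1
  rw [Equiv.swap_apply_left] at h0
  rw [Equiv.swap_apply_right] at h1
  obtain ⟨z, hz, hz'⟩ := h0.1.2.resolve_left fun h => zero_ne_one h.1
  obtain ⟨w, hw', hw⟩ := h1.1.2.resolve_left fun h => one_ne_zero h.1
  have hlength := (σ 0).isUnitSpeed_isAt.tspLength_le_of_exchange (σ 1).isUnitSpeed_isAt finite_univ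
    univ_nonempty (h0.2.1.trans h1.2.2) (h1.2.1.trans h0.2.2) hz hz' hw hw'
    fun s _ => Fin.exists_fin_two.1 (h.exists_isAt hσ ht s)
  linarith [h0.1.1, h1.1.1]

lemma exists_cyclicLatency_le_of_latency_le (hσ : latency σ ≤ L) :
    ∃ A : Set P, cyclicLatency A ≤ L := by
  obtain ⟨t, ht, hiff⟩ := exists_nonempty_linksAt_iff hσ
  have hperm : ∀ π : Equiv.Perm (Fin 2), π = 1 ∨ π = Equiv.swap 0 1 := by decide
  obtain ⟨π, l, r, h⟩ := exists_isStableMatching (isCompact_linksAt σ L t)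
    (fun i => ⟨_, self_mem_linksAt L.coe_nonneg t i⟩) hiff
  rcases hperm π with rfl | rfl
  · exact exists_cyclicLatency_le_of_isStableMatching_one hσ ht h
  · refine ⟨∅, ?_⟩
    rw [cyclicLatency_empty, div_le_iff₀' two_pos]
    exact tspLength_univ_le_of_isStableMatching_swap hσ ht h

lemma exists_ofReal_cyclicLatency_le (σ : PatrolSchedule 2 P) :
    ∃ A : Set P, ENNReal.ofReal (cyclicLatency A) ≤ latency σ := by
  rcases eq_or_ne (latency σ) ⊤ with htop | hfin
  · exact ⟨∅, htop ▸ le_top⟩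
  obtain ⟨A, hA⟩ := exists_cyclicLatency_le_of_latency_le (ENNReal.coe_toNNReal hfin).ge
  exact ⟨A, ENNReal.ofReal_le_of_le_toReal hA⟩

end LowerBound

end Patrol

theorem mainTheorem3 {P : Type*} [MetricSpace P] [Finite P] [Nonempty P] :
    (∃ σ : Patrol.PatrolSchedule 2 P, Patrol.IsOptimalCyclic σ) ∧
      ∀ σ : Patrol.PatrolSchedule 2 P, Patrol.IsOptimalCyclic σ → Patrol.IsOptimal σ := by
  obtain ⟨A, hA⟩ := Finite.exists_min (Patrol.cyclicLatency (P := P))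
  obtain ⟨σ, hcyclic, hσ⟩ := Patrol.exists_isCyclic_latency_le_cyclicLatency A
  have hopt : Patrol.IsOptimal σ := fun τ => by
    obtain ⟨B, hB⟩ := Patrol.exists_ofReal_cyclicLatency_le τ
    calc
      Patrol.latency σ ≤ ENNReal.ofReal (Patrol.cyclicLatency A) := hσ
      _ ≤ ENNReal.ofReal (Patrol.cyclicLatency B) := ENNReal.ofReal_le_ofReal (hA B)
      _ ≤ Patrol.latency τ := hB
  exact ⟨⟨σ, hcyclic, fun τ _ => hopt τ⟩, fun σ' hσ' τ => (hσ'.2 σ hcyclic).trans (hopt τ)⟩
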